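/- Let $n\ge 0$ and $d\ge 3$ be integers and let $G$ be a forest (a finite simple graph without cycles) on the vertex set $[n]=\{1,\dots,n\}$. Let $L_G(d)\subset\mathbb{C}[x_{i,k} : 1\le i\le n,\ 1\le k\le d]$ be the ideal generated by the polynomials $f_{ij}=\sum_{k=1}^{d}x_{i,k}x_{j,k}$ for all edges $\{i,j\}\in E(G)$, and let $\mathrm{OR}_d(\overline{G})=\mathbb{V}(L_G(d))\subset\mathbb{C}^{nd}$ be its zero set, that is, the variety of all $n$-tuples $(v_1,\dots,v_n)\in(\mathbb{C}^d)^n$ with $\sum_{k=1}^d (v_i)_k(v_j)_k=0$ for every edge $\{i,j\}\in E(G)$. Write $N_G(i)$ for the set of neighbours of $i$ in $G$, and $G_{[n]\setminus S}$ for the subgraph of $G$ induced on $[n]\setminus S$. A subset $S\subseteq[n]$ is called $G$-admissible if for every $i\in S$ $$\bigl|N_G(i)\cap([n]\setminus S)\bigr|\ge d\quad\text{and}\quad N_G(i)\cap([n]\setminus S)\not\subseteq N_G(j)\cap([n]\setminus S)\ \text{ for every } j\in[n]\setminus S .$$ Then the dimension of the variety $\mathrm{OR}_d(\overline{G})$ (the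 Krull dimension of its coordinate ring) is $$\dim \mathrm{OR}_d(\overline{G})=\max\bigl\{\,d\,(n-|S|)-|E(G_{[n]\setminus S})| \;:\; S\subseteq[n]\ \text{is } G\text{-admissible}\,\bigr\}.$$ -/

import Mathlib

namespace LSS

/-- The edge polynomial `f_{ij} = ∑ k, x_{i,k} x_{j,k}` in the polynomial ring `ℂ[X]`, where
`X = (x_{i,k})` is an `n × d` matrix of indeterminates. -/
noncomputable def edgePoly {n : ℕ} (d : ℕ) (i j : Fin n) : MvPolynomial (Fin n × Fin d) ℂ :=
  ∑ k : Fin d, MvPolynomial.X (i, k) * MvPolynomial.X (j, k)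

/-- The Lovász–Saks–Schrijver ideal `L_G(d)`, generated by the edge polynomials of `G`. -/
noncomputable def lssIdeal {n : ℕ} (d : ℕ) (G : SimpleGraph (Fin n)) :
    Ideal (MvPolynomial (Fin n × Fin d) ℂ) :=
  Ideal.span {f | ∃ i j : Fin n, G.Adj i j ∧ f = edgePoly d i j}

/-- The variety `OR_d(Ḡ) = 𝕍(L_G(d)) ⊆ ℂ^{nd}` of orthogonal representations of the
complement of `G`. -/
noncomputable def orVariety {n : ℕ} (d : ℕ) (G : SimpleGraph (Fin n)) : Set (Fin n × Fin d → ℂ) :=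
  MvPolynomial.zeroLocus ℂ (lssIdeal d G)

/-- The dimension of an affine variety `V` over `ℂ`: the Krull dimension of its
coordinate ring `ℂ[x] / 𝕀(V)` (it is `⊥` for the empty set). -/
noncomputable def varietyDim {σ : Type*} (V : Set (σ → ℂ)) : WithBot ℕ∞ :=
  ringKrullDim (MvPolynomial σ ℂ ⧸ MvPolynomial.vanishingIdeal ℂ V)

/-- `S ⊆ [n]` is `G`-admissible (in dimension `d`): for every `i ∈ S`, the set
`N_G(i) ∩ ([n] ∖ S)` has at least `d` elements and is not contained in
`N_G(j) ∩ ([n] ∖ S)` for any `j ∈ [n] ∖ S`. -/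
def IsAdmissible {n : ℕ} (d : ℕ) (G : SimpleGraph (Fin n)) (S : Finset (Fin n)) : Prop :=
  ∀ i ∈ S,
    d ≤ (G.neighborSet i ∩ (S : Set (Fin n))ᶜ).ncard ∧
    ∀ j ∉ S, ¬ (G.neighborSet i ∩ (S : Set (Fin n))ᶜ ⊆ G.neighborSet j ∩ (S : Set (Fin n))ᶜ)

/-- The integer `d (n - |S|) - |E(G_{[n] ∖ S})|`, where `G_{[n] ∖ S}` is the subgraph of `G`
induced on `[n] ∖ S`. -/
noncomputable def expectedDim {n : ℕ} (d : ℕ) (G : SimpleGraph (Fin n)) (S : Finset (Fin n)) : ℤ :=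
  (d : ℤ) * ((n : ℤ) - (S.card : ℤ)) - ((G.induce (S : Set (Fin n))ᶜ).edgeSet.ncard : ℤ)

end LSS

/-!
For any `S ⊆ [n]`, admissible or not, the tuples in `OR_d(Ḡ)` that vanish on `S` are cut out of
`ℂ^{nd}` by `d |S|` coordinates and `|E(G_{[n] ∖ S})|` edge polynomials, all vanishing at the
origin. Krull's height theorem at the origin therefore gives `dim OR_d(Ḡ) ≥ expectedDim d G S`
(`LSS.le_ringKrullDim_quotient_lssIdeal`).

Conversely, an irreducible closed subset of `OR_d(Ḡ)` has a generic point `v` with entries in a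
domain `A`. Let `T` be the set of vertices `i` with `v i ≠ 0`. The induced forest on `T` is
built up by adding vertices of degree at most one; a new leaf is orthogonal to its nonzero
neighbour, which costs one of its `d` coordinates. So `A` has transcendence degree at most
`d |T| - |E(G_T)|`, which is `expectedDim d G Tᶜ`, and by Noether normalization the same bound
holds for the dimension (`SimpleGraph.IsAcyclic.exists_finset_forall_isAlgebraic`,
`ringKrullDim_le_trdeg`, `LSS.ringKrullDim_quotient_lssIdeal_le`).

Hence the dimension is the maximum of `expectedDim d G S` over all subsets `S`. It remains to see
that a maximizer is admissible (`LSS.isAdmissible_of_forall_expectedDim_le`): otherwise moving a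
vertex out of `S` would increase the value, or the forest would contain a 4-cycle.
-/

/-! ### Krull dimension and height -/

lemma ringKrullDim_le_of_isIntegral (R A : Type*) [CommRing R] [CommRing A] [Algebra R A]
    [Algebra.IsIntegral R A] : ringKrullDim A ≤ ringKrullDim R :=
  Order.krullDim_le_of_strictMono (PrimeSpectrum.comap (algebraMap R A))
    fun p _ h => Ideal.IsIntegral.comap_lt_comap (I := p.asIdeal) h

/-- By Noether normalization: `A` is integral over a polynomial ring on `s` variables, which has
Krull dimension `s` and transcendence degree `s`. -/
lemma ringKrullDim_le_trdeg (k A : Type*) [Field k] [CommRing A] [IsDomain A] [Algebra k A]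
    [Algebra.FiniteType k A] {N : ℕ} (hN : Algebra.trdeg k A ≤ N) :
    ringKrullDim A ≤ N := by
  obtain ⟨s, g, hg, hint⟩ := exists_integral_inj_algHom_of_fg k A
  have hs : s ≤ N := by
    have h := lift_trdeg_le_of_injective g hg
    rw [MvPolynomial.trdeg_of_isDomain] at h
    simp only [Cardinal.mk_fin, Cardinal.lift_natCast] at h
    have h' := h.trans (Cardinal.lift_le.2 hN)
    simpa using h'
  algebraize [g.toRingHom]
  have : Algebra.IsIntegral (MvPolynomial (Fin s) k) A := ⟨hint⟩
  refine (ringKrullDim_le_of_isIntegral (MvPolynomial (Fin s) k) A).trans ?_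
  rw [MvPolynomial.ringKrullDim_of_isNoetherianRing]
  simpa using mod_cast hs

lemma ringKrullDim_le_of_forall_quotient_prime {A : Type*} [CommRing A] {N : WithBot ℕ∞}
    (h : ∀ p : Ideal A, p.IsPrime → ringKrullDim (A ⧸ p) ≤ N) : ringKrullDim A ≤ N := by
  rw [ringKrullDim, Order.krullDim_eq_iSup_coheight]
  refine iSup_le fun p => ?_
  have := h p.asIdeal p.isPrime
  rw [ringKrullDim_quotient] at this
  rw [Order.coheight_eq_krullDim_Ici]
  exact this

lemma Polynomial.height_eq_height_comap_C_add_one {R : Type*} [CommRing R] [IsNoetherianRing R]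
    (P : Ideal (Polynomial R)) [P.IsMaximal] :
    P.height = (P.comap (Polynomial.C : R →+* Polynomial R)).height + 1 :=
  Polynomial.height_eq_height_add_one (P.under R) P

/-- A maximal ideal of a polynomial ring over a field restricts to a maximal ideal of the
polynomial ring on one variable less, since polynomial rings over fields are Jacobson rings; so
the height goes up by one with each variable. -/
lemma MvPolynomial.height_eq_natCard_of_isMaximal {k : Type*} [Field k] {ι : Type*} [Finite ι]
    (M : Ideal (MvPolynomial ι k)) [M.IsMaximal] : M.height = Nat.card ι := by
  suffices H : ∀ M : Ideal (MvPolynomial ι k), M.IsMaximal → M.height = Nat.card ι from H M ‹_›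
  clear! M
  induction ι using Finite.induction_empty_option with
  | of_equiv e H =>
    intro M hM
    rw [← (renameEquiv k e).toRingEquiv.height_comap, H, Nat.card_congr e]
    exact Ideal.comap_isMaximal_of_surjective _ (renameEquiv k e).surjective
  | h_empty =>
    intro M hM
    have hf := (isEmptyRingEquiv k PEmpty).toMulEquiv.isField (Field.toIsField k)
    let := hf.toField
    rw [(Ideal.eq_bot_or_top M).resolve_right hM.ne_top]
    simp
  | @h_option α _ IH =>
    intro M hM
    let e := (optionEquivLeft k α).toRingEquiv.symm
    rw [← RingEquiv.height_comap e]
    have hP : (M.comap e).IsMaximal :=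
      Ideal.comap_isMaximal_of_surjective _ e.surjective
    rw [Polynomial.height_eq_height_comap_C_add_one, IH]
    · simp
    · exact Polynomial.isMaximal_comap_C_of_isJacobsonRing _

/-! ### Induced subgraphs of forests -/

namespace SimpleGraph

variable {V : Type*} {G : SimpleGraph V}

lemma ncard_edgeSet_induce_insert [Finite V] (G : SimpleGraph V) {T : Set V} {i : V}
    (hi : i ∉ T) :
    (G.induce (insert i T)).edgeSet.ncard =
      (G.induce T).edgeSet.ncard + (G.neighborSet i ∩ T).ncard := by
  have key : ∀ T : Set V, (G.induce T).edgeSet.ncard =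
      (G.edgeSet ∩ {e | ∀ v ∈ e, v ∈ T}).ncard := by
    intro T
    rw [← Set.ncard_image_of_injective _ (Sym2.map.injective
      (Subtype.val_injective (p := (· ∈ T))))]
    congr 1
    ext e
    constructor
    · rintro ⟨e, he, rfl⟩
      induction e with | _ a b => simpa using he
    · induction e with | _ a b =>
      rintro ⟨h, h'⟩
      exact ⟨s(⟨a, h' a (by simp)⟩, ⟨b, h' b (by simp)⟩), by simpa using h, rfl⟩
  have himg : (G.neighborSet i ∩ T).ncard = ((fun j => s(i, j)) '' (G.neighborSet i ∩ T)).ncard :=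
    (Set.ncard_image_of_injective _ (Sym2.mkEmbedding i).injective).symm
  rw [key, key, himg, ← Set.ncard_union_eq ?_ (Set.toFinite _) (Set.toFinite _)]
  · congr 1
    ext e
    induction e with | _ a b =>
    have := G.adj_comm a b
    have := G.ne_of_adj (a := a) (b := b)
    simp only [Set.mem_inter_iff, mem_edgeSet, Set.mem_ofPred_eq, Sym2.mem_iff, forall_eq_or_imp,
      forall_eq, Set.mem_insert_iff, Set.mem_union, Set.mem_image, mem_neighborSet, Sym2.eq_iff]
    grind
  · rw [Set.disjoint_left]
    rintro _ ⟨-, h⟩ ⟨j, -, rfl⟩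
    exact hi (h i (by simp))

lemma ncard_edgeSet_induce_empty (G : SimpleGraph V) :
    (G.induce (∅ : Set V)).edgeSet.ncard = 0 := by
  rw [Set.eq_empty_of_isEmpty (G.induce (∅ : Set V)).edgeSet, Set.ncard_empty]

/-- The end of a longest path in the induced forest has at most one neighbour. -/
lemma IsAcyclic.exists_ncard_neighborSet_inter_le_one [Finite V] (hG : G.IsAcyclic) {T : Set V}
    (hT : T.Nonempty) : ∃ j ∈ T, (G.neighborSet j ∩ T).ncard ≤ 1 := by
  classical
  have := Fintype.ofFinite V
  have hH := hG.induce T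
  set H := G.induce T
  obtain ⟨t, ht⟩ := hT
  have hb : BddAbove {m | ∃ (u v : T) (p : H.Walk u v), p.IsPath ∧ p.length = m} := by
    refine ⟨Fintype.card T, ?_⟩
    rintro _ ⟨u, v, p, hp, rfl⟩
    exact hp.length_lt.le
  obtain ⟨u, v, p, hp, hl⟩ := Nat.sSup_mem
    (s := {m | ∃ (u v : T) (p : H.Walk u v), p.IsPath ∧ p.length = m})
    ⟨0, ⟨t, ht⟩, ⟨t, ht⟩, .nil, .nil, rfl⟩ hb
  refine ⟨v, v.2, ?_⟩
  have key : ∀ w : T, H.Adj v w → w = p.penultimate := by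
    intro w hw
    by_cases hs : w ∈ p.support
    · exact hH.eq_penultimate_of_adj_end hp hw hs
    · have := le_csSup hb ⟨u, w, p.concat hw, hp.concat hs hw, rfl⟩
      rw [Walk.length_concat, ← hl] at this
      omega
  rw [Set.ncard_le_one (Set.toFinite _)]
  rintro a ⟨ha, haT⟩ b ⟨hb, hbT⟩
  have h1 := key ⟨a, haT⟩ ha
  have h2 := key ⟨b, hbT⟩ hb
  exact congrArg Subtype.val (h1.trans h2.symm)

lemma IsAcyclic.eq_of_common_neighbors (hG : G.IsAcyclic) {i j a b : V} (hij : i ≠ j)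
    (hia : G.Adj i a) (hib : G.Adj i b) (hja : G.Adj j a) (hjb : G.Adj j b) : a = b := by
  have h := (hG.subsingleton_path i j).elim
    (⟨.cons hia (.cons hja.symm .nil), by simp [hia.ne, hij, hja.ne']⟩ : G.Path i j)
    (⟨.cons hib (.cons hjb.symm .nil), by simp [hib.ne, hij, hjb.ne']⟩ : G.Path i j)
  simpa using congrArg (fun p : G.Path i j => (p : G.Walk i j).support) h

end SimpleGraph

/-! ### Orthogonal tuples on a forest -/

/-- One vertex of degree at most one is added at a time. It contributes its `d` coordinates, or only
`d - 1` of them if it has a neighbour `a`: the equation of the edge then determines the coordinate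
at which `v a` has a nonzero entry. -/
lemma SimpleGraph.IsAcyclic.exists_finset_forall_isAlgebraic {V : Type*} [Finite V]
    {G : SimpleGraph V} (hG : G.IsAcyclic) {k A : Type*} [Field k] [CommRing A] [IsDomain A]
    [Algebra k A] {d : ℕ} (v : V → Fin d → A) (hv : ∀ i j, G.Adj i j → ∑ l, v i l * v j l = 0)
    (T : Finset V) (hT : ∀ i ∈ T, v i ≠ 0) :
    ∃ B : Finset A, B.card + (G.induce (T : Set V)).edgeSet.ncard ≤ d * T.card ∧
      ∀ i ∈ T, ∀ l, IsAlgebraic (Algebra.adjoin k (B : Set A)) (v i l) := by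
  classical
  induction hn : T.card generalizing T with
  | zero =>
    obtain rfl := Finset.card_eq_zero.1 hn
    refine ⟨∅, ?_, by simp⟩
    rw [Finset.coe_empty, G.ncard_edgeSet_induce_empty]
    simp
  | succ m ih =>
    obtain ⟨j, hj, hdeg⟩ := hG.exists_ncard_neighborSet_inter_le_one (T := (T : Set V))
      (Finset.coe_nonempty.2 (Finset.card_pos.1 (by omega)))
    obtain ⟨B, hB, halg⟩ := ih (T.erase j) (fun i hi => hT i (Finset.mem_of_mem_erase hi))
      (by rw [Finset.card_erase_of_mem hj]; omega)
    have hedge := G.ncard_edgeSet_induce_insert (T := ((T.erase j : Finset V) : Set V)) (i := j)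
      (by simp)
    have hsub : G.neighborSet j ∩ ((T.erase j : Finset V) : Set V) ⊆ G.neighborSet j ∩ T :=
      Set.inter_subset_inter_right _ (Finset.coe_subset.2 (T.erase_subset j))
    rw [← Finset.coe_insert, Finset.insert_erase hj] at hedge
    have halg_union : ∀ C : Finset A, ∀ i ∈ T, i ≠ j → ∀ l,
        IsAlgebraic (Algebra.adjoin k ((B ∪ C : Finset A) : Set A)) (v i l) := fun C i hi hij l =>
      (halg i (Finset.mem_erase.2 ⟨hij, hi⟩) l).tower_top_of_subalgebra_le
        (Algebra.adjoin_mono (by simp))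
    have halg_mem : ∀ C : Finset A, ∀ x ∈ C,
        IsAlgebraic (Algebra.adjoin k ((B ∪ C : Finset A) : Set A)) x := fun C x hx =>
      isAlgebraic_algebraMap (⟨x, Algebra.subset_adjoin (by simp [hx])⟩ :
        Algebra.adjoin k ((B ∪ C : Finset A) : Set A))
    obtain hempty | ⟨a, haj, haT⟩ :=
      (G.neighborSet j ∩ ((T.erase j : Finset V) : Set V)).eq_empty_or_nonempty
    · refine ⟨B ∪ Finset.univ.image (v j), ?_, fun i hi l => ?_⟩
      · have := Finset.card_union_le B (Finset.univ.image (v j))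
        have : (Finset.univ.image (v j)).card ≤ d :=
          Finset.card_image_le.trans_eq (by simp)
        rw [hempty, Set.ncard_empty] at hedge
        linarith
      · obtain rfl | hij := eq_or_ne i j
        · exact halg_mem _ _ (by simp)
        · exact halg_union _ i hi hij l
    · obtain ⟨haj', haT'⟩ : a ≠ j ∧ a ∈ T := Finset.mem_erase.1 haT
      obtain ⟨l₀, hl₀⟩ := Function.ne_iff.1 (hT a haT')
      set C := (Finset.univ.erase l₀).image (v j) with hC
      have hCalg : ∀ l ≠ l₀, IsAlgebraic (Algebra.adjoin k ((B ∪ C : Finset A) : Set A)) (v j l) :=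
        fun l hl => halg_mem C _ (Finset.mem_image_of_mem _ (by simp [hl]))
      refine ⟨B ∪ C, ?_, fun i hi l => ?_⟩
      · have := Finset.card_union_le B C
        have h1 : C.card + 1 ≤ d := by
          have h2 : C.card ≤ _ := Finset.card_image_le
          rw [Finset.card_erase_of_mem (Finset.mem_univ _), Finset.card_univ,
            Fintype.card_fin] at h2
          have := l₀.pos
          omega
        have := Set.ncard_le_ncard hsub
        linarith
      · obtain rfl | hij := eq_or_ne i j
        · obtain rfl | hl := eq_or_ne l l₀
          · refine IsAlgebraic.of_mul (mem_nonZeroDivisors_of_ne_zero hl₀)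
              (halg_union C a haT' haj' l) ?_
            have hsum := hv a i (G.adj_symm haj)
            rw [← Finset.add_sum_erase _ _ (Finset.mem_univ l)] at hsum
            rw [eq_neg_of_add_eq_zero_left hsum]
            refine IsAlgebraic.neg <| sum_mem
              (S := Subalgebra.algebraicClosure (Algebra.adjoin k ((B ∪ C : Finset A) : Set A)) A)
              fun l' hl' => ?_
            exact (halg_union C a haT' haj' l').mul (hCalg l' (Finset.ne_of_mem_erase hl'))
          · exact hCalg l hl
        · exact halg_union C i hi hij l

/-- The vertices outside `T` contribute nothing, so the transcendence degree of the domain `A`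
generated by the coordinates of `v` is at most the number of elements over which the coordinates
at `T` are algebraic. -/
lemma ringKrullDim_le_of_forest {V : Type*} [Fintype V]
    {G : SimpleGraph V} (hG : G.IsAcyclic) {k A : Type*} [Field k] [CommRing A] [IsDomain A]
    [Algebra k A] {d : ℕ} (v : V → Fin d → A) (hv : ∀ i j, G.Adj i j → ∑ l, v i l * v j l = 0)
    (hgen : Function.Surjective (MvPolynomial.aeval (R := k) fun p : V × Fin d => v p.1 p.2))
    (T : Finset V) (hT : ∀ i, i ∈ T ↔ v i ≠ 0) :
    ∃ m : ℕ, m + (G.induce (T : Set V)).edgeSet.ncard ≤ d * T.card ∧ ringKrullDim A ≤ m := by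
  obtain ⟨B, hB, halg⟩ := hG.exists_finset_forall_isAlgebraic (k := k) v hv T fun i => (hT i).1
  refine ⟨B.card, hB, ?_⟩
  have : Algebra.FiniteType k A := .of_surjective _ hgen
  have : Algebra.IsAlgebraic (Algebra.adjoin k (B : Set A)) A := by
    refine ⟨fun x => ?_⟩
    obtain ⟨f, rfl⟩ := hgen x
    induction f using MvPolynomial.induction_on with
    | C c =>
      rw [MvPolynomial.aeval_C, IsScalarTower.algebraMap_apply k (Algebra.adjoin k (B : Set A)) A]
      exact isAlgebraic_algebraMap _
    | add p q hp hq => rw [map_add]; exact hp.add hq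
    | mul_X p i hp =>
      rw [map_mul, MvPolynomial.aeval_X]
      refine hp.mul ?_
      by_cases hi : i.1 ∈ T
      · exact halg _ hi _
      · rw [not_not.1 (mt (hT i.1).2 hi)]
        exact isAlgebraic_zero
  refine ringKrullDim_le_trdeg k A ?_
  simpa using Algebra.IsAlgebraic.trdeg_le_cardinalMk k (B : Set A)

/-! ### The coordinate ring -/

namespace LSS
open MvPolynomial

/-- By the Nullstellensatz the coordinate ring is the quotient by the radical of `L_G(d)`, and
passing to the radical does not change the spectrum. -/
lemma varietyDim_orVariety {n : ℕ} (d : ℕ) (G : SimpleGraph (Fin n)) :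
    varietyDim (orVariety d G) =
      ringKrullDim (MvPolynomial (Fin n × Fin d) ℂ ⧸ lssIdeal d G) := by
  rw [varietyDim, orVariety, vanishingIdeal_zeroLocus_eq_radical, ringKrullDim_quotient,
    ringKrullDim_quotient, PrimeSpectrum.zeroLocus_radical]

/-! ### Lower bound -/

/-- Krull's height theorem at the origin, for the subvariety of tuples vanishing on `S`, which is
cut out by `d |S|` coordinates and the edge polynomials of the edges avoiding `S`. -/
lemma le_ringKrullDim_quotient_lssIdeal {n : ℕ} (d : ℕ) (G : SimpleGraph (Fin n))
    (S : Finset (Fin n)) :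
    ((n * d : ℕ) : WithBot ℕ∞) ≤
      ringKrullDim (MvPolynomial (Fin n × Fin d) ℂ ⧸ lssIdeal d G) +
        ((S.card * d + (G.induce (S : Set (Fin n))ᶜ).edgeSet.ncard : ℕ) : WithBot ℕ∞) := by
  classical
  set E := (G.induce (S : Set (Fin n))ᶜ).edgeSet
  have hcomm : ∀ i j : Fin n, edgePoly d i j = edgePoly d j i := fun i j => by
    simp only [edgePoly, mul_comm]
  let F : Sym2 ((S : Set (Fin n))ᶜ : Set (Fin n)) → MvPolynomial (Fin n × Fin d) ℂ :=
    Sym2.lift ⟨fun i j => edgePoly d i j, fun i j => hcomm i j⟩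
  let s : Set (MvPolynomial (Fin n × Fin d) ℂ) :=
    X '' (S ×ˢ (Finset.univ : Finset (Fin d)) : Finset (Fin n × Fin d)) ∪ F '' E
  have hcard : s.ncard ≤ S.card * d + E.ncard := by
    refine (Set.ncard_union_le _ _).trans (add_le_add ?_ (Set.ncard_image_le (Set.toFinite _)))
    refine (Set.ncard_image_le (Finset.finite_toSet _)).trans ?_
    rw [Set.ncard_coe_finset]
    simp
  have hle : lssIdeal d G ≤ Ideal.span s := by
    rw [lssIdeal, Ideal.span_le]
    rintro _ ⟨i, j, hij, rfl⟩
    have hS : ∀ i ∈ S, ∀ j, edgePoly d i j ∈ Ideal.span s := fun i hi j =>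
      Ideal.sum_mem _ fun k _ => Ideal.mul_mem_right _ _ <|
        Ideal.subset_span (Or.inl ⟨(i, k), by simpa using hi, rfl⟩)
    by_cases hi : i ∈ S
    · exact hS i hi j
    by_cases hj : j ∈ S
    · exact hcomm i j ▸ hS j hj i
    · exact Ideal.subset_span (Or.inr ⟨s(⟨i, hi⟩, ⟨j, hj⟩), hij, rfl⟩)
  have hs : s ⊆ (vanishingIdeal ℂ {(0 : Fin n × Fin d → ℂ)} : Ideal _) := by
    rintro _ (⟨p, -, rfl⟩ | ⟨e, -, rfl⟩)
    · simp
    · induction e with | _ a b =>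
      simp [F, edgePoly]
  have h := Ideal.height_le_ringKrullDim_quotient_add_encard s hs
  rw [MvPolynomial.height_eq_natCard_of_isMaximal] at h
  have hfin : s.Finite := ((Finset.finite_toSet _).image _).union (Set.toFinite _)
  rw [← hfin.cast_ncard_eq] at h
  simp only [Nat.card_eq_fintype_card, Fintype.card_prod, Fintype.card_fin] at h
  refine h.trans (add_le_add (ringKrullDim_le_of_surjective (Ideal.Quotient.factor hle)
    (Ideal.Quotient.factor_surjective hle)) ?_)
  exact_mod_cast hcard

/-! ### Upper bound -/

/-- The quotient by a prime `p` is the coordinate ring of an irreducible subvariety whose generic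
point is nonzero exactly at the vertices outside some `S`. -/
lemma ringKrullDim_quotient_lssIdeal_le {n : ℕ} (d : ℕ) {G : SimpleGraph (Fin n)}
    (hG : G.IsAcyclic) {D : ℕ} (hD : ∀ S : Finset (Fin n), expectedDim d G S ≤ D) :
    ringKrullDim (MvPolynomial (Fin n × Fin d) ℂ ⧸ lssIdeal d G) ≤ D := by
  classical
  refine ringKrullDim_le_of_forall_quotient_prime fun p hp => ?_
  let φ := (Ideal.Quotient.mkₐ ℂ p).comp (Ideal.Quotient.mkₐ ℂ (lssIdeal d G))
  let v : Fin n → Fin d → _ := fun i k => φ (X (i, k))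
  have haeval : aeval (R := ℂ) (fun q : Fin n × Fin d => v q.1 q.2) = φ := by
    ext q
    simp [v]
  have hv : ∀ i j, G.Adj i j → ∑ k, v i k * v j k = 0 := fun i j hij => by
    have : φ (edgePoly d i j) = 0 := by
      have : Ideal.Quotient.mk (lssIdeal d G) (edgePoly d i j) = 0 :=
        Ideal.Quotient.eq_zero_iff_mem.2 (Ideal.subset_span ⟨i, j, hij, rfl⟩)
      simp [φ, this]
    simpa [edgePoly] using this
  obtain ⟨T, hT⟩ : ∃ T : Finset (Fin n), ∀ i, i ∈ T ↔ v i ≠ 0 :=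
    ⟨Finset.univ.filter fun i => v i ≠ 0, by simp⟩
  obtain ⟨m, hm, hdim⟩ := ringKrullDim_le_of_forest hG (k := ℂ) v hv
    (by rw [haeval]
        exact (Ideal.Quotient.mkₐ_surjective ℂ p).comp (Ideal.Quotient.mkₐ_surjective ℂ _))
    T hT
  refine hdim.trans ?_
  have h := hD Tᶜ
  have hTn : T.card ≤ n := by simpa using T.card_le_univ
  rw [expectedDim, Finset.card_compl, Fintype.card_fin, Finset.coe_compl, compl_compl,
    Nat.cast_sub hTn, sub_sub_cancel] at h
  have : m ≤ D := by
    zify at hm ⊢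
    generalize ((G.induce (T : Set (Fin n))).edgeSet.ncard : ℤ) = e at h hm
    linarith
  exact_mod_cast this

/-! ### Maximizers of the expected dimension -/

/-- Moving `i` out of `S` changes the expected dimension by `d` minus the number of neighbours of
`i` outside `S`, so this number is at least `d`. Since `d ≥ 2`, two vertices whose
neighbourhoods outside `S` are nested would span a 4-cycle. -/
lemma isAdmissible_of_forall_expectedDim_le {n d : ℕ} (hd : 2 ≤ d) {G : SimpleGraph (Fin n)}
    (hG : G.IsAcyclic) {S : Finset (Fin n)}
    (hS : ∀ S' : Finset (Fin n), expectedDim d G S' ≤ expectedDim d G S) :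
    IsAdmissible d G S := by
  classical
  intro i hi
  have hcard : d ≤ (G.neighborSet i ∩ (S : Set (Fin n))ᶜ).ncard := by
    have h := hS (S.erase i)
    have hc : ((S.erase i : Finset (Fin n)) : Set (Fin n))ᶜ = insert i (S : Set (Fin n))ᶜ := by
      ext x
      by_cases x = i <;> simp_all
    have he := G.ncard_edgeSet_induce_insert (T := (S : Set (Fin n))ᶜ) (i := i) (by simpa using hi)
    rw [← hc] at he
    have hp : 0 < S.card := Finset.card_pos.2 ⟨i, hi⟩
    rw [expectedDim, expectedDim, he, Finset.card_erase_of_mem hi, Nat.cast_sub hp] at h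
    push_cast at h
    zify
    linarith
  refine ⟨hcard, fun j hj hsub => ?_⟩
  obtain ⟨a, b, ha, hb, hab⟩ := (Set.one_lt_ncard_iff (Set.toFinite _)).1
    (lt_of_lt_of_le hd hcard)
  exact hab (hG.eq_of_common_neighbors (by rintro rfl; exact hj hi) ha.1 hb.1
    (hsub ha).1 (hsub hb).1)

end LSS

/-! ### The dimension formula -/

theorem corollary4p3 (n d : ℕ) (hd : 3 ≤ d) (G : SimpleGraph (Fin n)) (hG : G.IsAcyclic) :
    ∃ D : ℕ, LSS.varietyDim (LSS.orVariety d G) = (D : WithBot ℕ∞) ∧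
      IsGreatest {m : ℤ | ∃ S : Finset (Fin n), LSS.IsAdmissible d G S ∧
        m = LSS.expectedDim d G S} (D : ℤ) := by
  obtain ⟨S, -, hS⟩ := Finset.exists_max_image Finset.univ (LSS.expectedDim d G)
    Finset.univ_nonempty
  replace hS := fun S' => hS S' (Finset.mem_univ S')
  have hnonneg : 0 ≤ LSS.expectedDim d G S := by
    -- the subset `S = [n]`, that is, the origin, has expected dimension `0`
    refine le_of_eq_of_le ?_ (hS Finset.univ)
    rw [LSS.expectedDim, Finset.coe_univ, Set.compl_univ, G.ncard_edgeSet_induce_empty]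
    simp
  obtain ⟨D, hD⟩ := Int.eq_ofNat_of_zero_le hnonneg
  refine ⟨D, ?_, ⟨S, LSS.isAdmissible_of_forall_expectedDim_le (by omega) hG hS, hD.symm⟩, ?_⟩
  · rw [LSS.varietyDim_orVariety]
    refine le_antisymm (LSS.ringKrullDim_quotient_lssIdeal_le d hG fun S' => hD ▸ hS S') ?_
    have h := LSS.le_ringKrullDim_quotient_lssIdeal d G S
    have hle : S.card ≤ n := by simpa using S.card_le_univ
    have heq : n * d = D + (S.card * d + (G.induce (S : Set (Fin n))ᶜ).edgeSet.ncard) := by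
      rw [LSS.expectedDim] at hD
      zify
      linarith
    rw [heq, Nat.cast_add] at h
    exact ENat.WithBot.add_le_add_natCast_right_iff.1 h
  · rintro _ ⟨S', -, rfl⟩
    exact hD ▸ hS S'
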